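/- Let $n\ge 1$ and $\mathbf b=(b_1,\dots,b_n)\in\mathbb Z_{>0}^n$, and assume that it is not the case that $n=1=b_1$. A $\mathbf b$-parking function is a list $(\beta_1,\dots,\beta_n)$ of positive integers whose nondecreasing rearrangement $\beta'_1\le\dots\le\beta'_n$ satisfies $\beta'_i\le b_1+\dots+b_i$ for all $i$; let $\mathcal X_n(\mathbf b)\subset\mathbb R^n$ be the convex hull of all $\mathbf b$-parking functions. Put $S_i=b_1+\dots+b_i$ for $1\le i\le n$ and $\mathbf y_k=(1,\dots,1,S_{k+1},S_{k+2},\dots,S_n)\in\mathbb R^n$ for $0\le k\le n$ (with $k$ leading ones), and let $\pi\in\mathfrak S_n$ act linearly on $\mathbb R^n$ by $\pi(\mathbf e_i)=\mathbf e_{\pi(i)}$. Write $(i,j)$ for the transposition of $i$ and $j$ (the identity if $i=j$). Two vertices share an edge if they are distinct and the segment joining them is a face of the polytope. **Proposition.** Let $\mathbf v$ and $\mathbf w$ be vertices of $\mathcal X_n(\mathbf b)$, and fix $\pi\in\mathfrak S_n$ and an integer $k$ with $0\le k\le n$ such that $\mathbf v=\pi(\mathbf y_k)$. (a) If $b_1\ge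 2$, or if $b_1=1$ and $k\ge 2$, then $\mathbf v$ and $\mathbf w$ share an edge of $\mathcal X_n(\mathbf b)$ if and only if one of the following holds: 1. $\mathbf w=(\pi\circ(j,k))(\mathbf y_{k-1})$ for some $1\le j\le k$, in which case $\mathbf w-\mathbf v=(S_k-1)\,\mathbf e_{\pi(j)}$; 2. $\mathbf w=(\pi\circ(j-1,j))(\mathbf y_k)$ for some $k+2\le j\le n$, in which case $\mathbf w-\mathbf v=b_j(\mathbf e_{\pi(j-1)}-\mathbf e_{\pi(j)})$; 3. $k\le n-1$ and $\mathbf w=\pi(\mathbf y_{k+1})$, in which case $\mathbf w-\mathbf v=-(S_{k+1}-1)\,\mathbf e_{\pi(k+1)}$. (b) If $b_1=1$ and $k\in\{0,1\}$ (so that $\mathbf y_k=\mathbf y_0=\mathbf y_1$), then $\mathbf v$ and $\mathbf w$ share an edge of $\mathcal X_n(\mathbf b)$ if and only if one of the following holds: 1. $\mathbf w=(\pi\circ(j-1,j))(\mathbf y_1)$ for some $2\le j\le n$, in which case $\mathbf w-\mathbf v=b_j(\mathbf e_{\pi(j-1)}-\mathbf e_{\pi(j)})$; 2. $\mathbf w=\pi(\mathbf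 y_2)$, in which case $\mathbf w-\mathbf v=-b_2\,\mathbf e_{\pi(2)}$. -/

import Mathlib

namespace ParkingPolytope

/-- The partial sum `S_i = b_1 + ⋯ + b_i`. The entry `b_j` is `b ⟨j - 1, _⟩`, so `S_i` is the sum
of the entries of `b` at the (zero-based) indices `< i`. -/
def partialSum {n : ℕ} (b : Fin n → ℕ) (i : ℕ) : ℕ :=
  ∑ j ∈ Finset.univ.filter (fun j : Fin n => (j : ℕ) < i), b j

/-- `β` is a `b`-parking function: its entries are positive integers, and its nondecreasing
rearrangement `β' = β ∘ Tuple.sort β` satisfies `β'_i ≤ b_1 + ⋯ + b_i` for all `i`. -/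
def IsParkingFunction {n : ℕ} (b : Fin n → ℕ) (β : Fin n → ℕ) : Prop :=
  (∀ i, 1 ≤ β i) ∧ ∀ i : Fin n, (β ∘ Tuple.sort β) i ≤ partialSum b ((i : ℕ) + 1)

/-- The `b`-parking-function polytope: the convex hull in `ℝⁿ` of all `b`-parking functions. -/
def parkingPolytope {n : ℕ} (b : Fin n → ℕ) : Set (Fin n → ℝ) :=
  convexHull ℝ {x | ∃ β : Fin n → ℕ, IsParkingFunction b β ∧ x = fun i => (β i : ℝ)}

/-- The vector `y_k = (1, …, 1, S_{k+1}, S_{k+2}, …, S_n)`, with `k` leading ones. -/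
def yVec {n : ℕ} (b : Fin n → ℕ) (k : ℕ) : Fin n → ℝ :=
  fun i => if (i : ℕ) < k then 1 else (partialSum b ((i : ℕ) + 1) : ℝ)

/-- The linear action of the symmetric group on `ℝⁿ`: `π (∑ a_i e_i) = ∑ a_i e_{π i}`. -/
def permAct {n : ℕ} (π : Equiv.Perm (Fin n)) (x : Fin n → ℝ) : Fin n → ℝ :=
  ∑ i, x i • Pi.single (π i) (1 : ℝ)

/-- `v` is a vertex of the polytope `P`. -/
def IsVertex {n : ℕ} (P : Set (Fin n → ℝ)) (v : Fin n → ℝ) : Prop :=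
  v ∈ P.extremePoints ℝ

/-- The points `v` and `w` share an edge of the polytope `P`: they are distinct, and the segment
joining them is a face of `P`, i.e. the set of maximizers on `P` of some linear functional. -/
def SharesEdge {n : ℕ} (P : Set (Fin n → ℝ)) (v w : Fin n → ℝ) : Prop :=
  v ≠ w ∧ IsExposed ℝ P (segment ℝ v w)

end ParkingPolytope

open ParkingPolytope

/-!
The polytope is simple, and its edges at a vertex can be read off from the tangent cone there. Every
point of the polytope satisfies `x_i ≥ 1` (`one_le_of_mem`) and, for every `m`, the sum of any `n - m`
of its coordinates is at most `S_{m+1} + ⋯ + S_n` (`tailSum_le`, by the rearrangement inequality). At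
`π(y_k)` the inequalities `x_{π(i)} ≥ 1` for `i ≤ k` and those for the sets `{π(m+1), …, π(n)}` with
`m ≥ k` are tight. These are `n` linearly independent conditions, so `π(y_k)` is a vertex
(`permAct_yVec_mem_extremePoints`), and the polytope lies in the simplicial cone at `π(y_k)` which
they cut out. The generators of this cone are, up to positive factors, the vectors dual to the
conditions, and these turn out to be the differences `w - v` listed in the theorem.

Given the duality, `sharesEdge_iff_of_dual` concludes. Let `v + d_i` be the vertices along the rays of
the cone. The sum of the tight functionals other than the `i`-th exposes the part of the polytope on
the `i`-th ray, which ends at the extreme point `v + d_i`. Conversely, a functional which exposes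
`[v, w]` is nonpositive on every `d_j`, so it vanishes on each `d_j` occurring in `w - v`; for such a
`j` the extreme point `v + d_j` lies on `[v, w]`, hence equals `w`.

If `b_1 = 1` and `k ≤ 1` then `y_0 = y_1`, and `n + 1` of the inequalities are tight. The one for
`{π(2), …, π(n)}` is implied by the one for all coordinates and `x_{π(1)} ≥ 1`, and leaving it out
gives again `n` independent conditions, with different dual vectors.
-/

namespace ParkingPolytope

variable {n : ℕ}

/-! ### Edges at a point with a simplicial tangent cone -/

/-- A point is extreme as soon as a family of linear functionals separating points attain their
minimum over the set there. -/
theorem mem_extremePoints_of_functionals {ι E : Type*} [AddCommGroup E] [Module ℝ E]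
    {P : Set E} {v : E} (g : ι → E →ₗ[ℝ] ℝ) (hv : v ∈ P)
    (hnonneg : ∀ i, ∀ x ∈ P, 0 ≤ g i (x - v)) (hinj : ∀ u, (∀ i, g i u = 0) → u = 0) :
    v ∈ P.extremePoints ℝ := by
  refine ⟨hv, ?_⟩
  rintro x hx y hy ⟨s, t, hs, ht, hst, hxy⟩
  refine sub_eq_zero.1 (hinj _ fun i => ?_)
  have hx' := hnonneg i x hx
  have hy' := hnonneg i y hy
  have hzero : s * g i (x - v) + t * g i (y - v) = 0 := by
    have h : s • (x - v) + t • (y - v) = 0 := by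
      have hv' : v = s • v + t • v := by rw [← add_smul, hst, one_smul]
      rw [smul_sub, smul_sub, sub_add_sub_comm, hxy, ← hv', sub_self]
    simpa using congrArg (g i) h
  nlinarith [mul_nonneg hs.le hx', mul_nonneg ht.le hy']

/-- If the functionals `g i` are nonnegative on `P - v`, separate points, and are dual to the
vectors `d i` up to positive scaling, then every vector is the combination of the `d i` with
coefficients `g i u / g i (d i)`, so that `P - v` lies in the simplicial cone spanned by the `d i`.
If moreover the points `v + d i` are extreme in `P`, they are exactly the endpoints of the edges
of `P` at `v`. -/
theorem sharesEdge_iff_of_dual {P : Set (Fin n → ℝ)} {v : Fin n → ℝ} {ι : Type*} [Fintype ι]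
    [DecidableEq ι] (g : ι → (Fin n → ℝ) →ₗ[ℝ] ℝ) (d : ι → Fin n → ℝ)
    (hP : Convex ℝ P) (hv : v ∈ P) (hd : ∀ i, v + d i ∈ P.extremePoints ℝ)
    (hnonneg : ∀ i, ∀ x ∈ P, 0 ≤ g i (x - v)) (hinj : ∀ u, (∀ i, g i u = 0) → u = 0)
    (hoff : ∀ i j, i ≠ j → g i (d j) = 0) (hdiag : ∀ i, 0 < g i (d i)) (w : Fin n → ℝ) :
    SharesEdge P v w ↔ ∃ i, w - v = d i := by
  have hdecomp (u : Fin n → ℝ) : u = ∑ i, (g i u / g i (d i)) • d i := by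
    refine sub_eq_zero.1 (hinj _ fun i => ?_)
    rw [map_sub, map_sum, Finset.sum_eq_single i]
    · rw [map_smul, smul_eq_mul, div_mul_cancel₀ _ (hdiag i).ne', sub_self]
    · intro j _ hj
      rw [map_smul, hoff i j hj.symm, smul_zero]
    · simp
  have hd0 (i) : d i ≠ 0 := fun h => by simpa [h] using hdiag i
  -- Extremality of `v + d i` means that `P` leaves the ray from `v` along `d i` at that point.
  have hray (i) (t : ℝ) (ht : v + t • d i ∈ P) : t ≤ 1 := by
    by_contra! h1
    have hmem : v + d i ∈ openSegment ℝ v (v + t • d i) := by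
      refine ⟨1 - 1 / t, 1 / t, ?_, by positivity, by ring, ?_⟩
      · have : 1 / t < 1 := by rw [div_lt_one (by linarith)]; exact h1
        linarith
      · rw [smul_add, smul_smul, one_div_mul_cancel (by linarith), one_smul, ← add_assoc,
          ← add_smul, sub_add_cancel, one_smul]
    have := (hd i).2 hv ht hmem
    exact hd0 i (by simpa using this.symm)
  constructor
  · rintro ⟨hvw, hexp⟩
    obtain ⟨l, hl⟩ := hexp ⟨v, left_mem_segment ℝ v w⟩
    have hvmax : v ∈ segment ℝ v w := left_mem_segment ℝ v w
    have hwmax : w ∈ segment ℝ v w := right_mem_segment ℝ v w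
    rw [hl] at hvmax hwmax
    have hlw : l (w - v) = 0 := by
      rw [map_sub]
      linarith [hvmax.2 w hwmax.1, hwmax.2 v hvmax.1]
    have hld (i) : l (d i) ≤ 0 := by
      have := hvmax.2 _ (hd i).1
      rw [map_add] at this
      linarith
    have hcoef (i) : 0 ≤ g i (w - v) / g i (d i) :=
      div_nonneg (hnonneg i w hwmax.1) (hdiag i).le
    have hsum : ∑ i, (g i (w - v) / g i (d i)) * l (d i) = 0 := by
      rw [hdecomp (w - v), map_sum] at hlw
      simpa only [map_smul, smul_eq_mul, ← hdecomp (w - v)] using hlw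
    have hterm := (Finset.sum_eq_zero_iff_of_nonpos
      (fun i _ => mul_nonpos_of_nonneg_of_nonpos (hcoef i) (hld i))).1 hsum
    obtain ⟨i, hi⟩ : ∃ i, g i (w - v) ≠ 0 := by
      by_contra! h
      exact hvw (sub_eq_zero.1 (hinj _ h)).symm
    have hli : l (d i) = 0 :=
      (mul_eq_zero.1 (hterm i (Finset.mem_univ i))).resolve_left (div_ne_zero hi (hdiag i).ne')
    have hmem : v + d i ∈ segment ℝ v w := by
      rw [hl]
      refine ⟨(hd i).1, fun y hy => ?_⟩
      rw [map_add, hli, add_zero]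
      exact hvmax.2 y hy
    refine ⟨i, ?_⟩
    rcases ((mem_extremePoints_iff_forall_segment.1 (hd i)).2 v hv w hwmax.1 hmem) with h | h
    · exact absurd (by simpa using h.symm) (hd0 i)
    · rw [h, add_sub_cancel_left]
  · rintro ⟨i, hi⟩
    obtain rfl : w = v + d i := by rw [← hi, add_sub_cancel]
    refine ⟨fun h => hd0 i (by simpa using h.symm), fun _ => ?_⟩
    -- The face is cut out by the sum of all the functionals except the one dual to `d i`.
    let f : (Fin n → ℝ) →ₗ[ℝ] ℝ := -∑ j ∈ Finset.univ.erase i, g j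
    have hf (u) : f u = -∑ j ∈ Finset.univ.erase i, g j u := by simp [f]
    have hfd : f (d i) = 0 := by
      rw [hf, Finset.sum_eq_zero, neg_zero]
      exact fun j hj => hoff j i (Finset.ne_of_mem_erase hj)
    have hle : ∀ x ∈ P, f (x - v) ≤ 0 := fun x hx => by
      rw [hf]
      exact neg_nonpos.2 (Finset.sum_nonneg fun j _ => hnonneg j x hx)
    refine ⟨LinearMap.toContinuousLinearMap f, Set.ext fun x => ?_⟩
    simp only [LinearMap.coe_toContinuousLinearMap', Set.mem_ofPred_eq]
    constructor
    · intro hx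
      refine ⟨hP.segment_subset hv (hd i).1 hx, fun y hy => ?_⟩
      rw [segment_eq_image'] at hx
      obtain ⟨t, -, rfl⟩ := hx
      have := hle y hy
      rw [map_sub] at this
      simp only [add_sub_cancel_left, map_add, map_smul, hfd]
      simpa using this
    · rintro ⟨hx, hmax⟩
      have hfx : f (x - v) = 0 := by
        refine le_antisymm (hle x hx) ?_
        rw [map_sub]
        linarith [hmax v hv]
      rw [hf, neg_eq_zero] at hfx
      have hzero := (Finset.sum_eq_zero_iff_of_nonneg fun j _ => hnonneg j x hx).1 hfx
      have hxd : x - v = (g i (x - v) / g i (d i)) • d i := by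
        conv_lhs => rw [hdecomp (x - v)]
        rw [Finset.sum_eq_single i]
        · intro j _ hj
          rw [hzero j (Finset.mem_erase.2 ⟨hj, Finset.mem_univ j⟩), zero_div, zero_smul]
        · simp
      have hxe : v + (g i (x - v) / g i (d i)) • d i = x := by rw [← hxd, add_sub_cancel]
      rw [segment_eq_image']
      refine ⟨g i (x - v) / g i (d i), ⟨div_nonneg (hnonneg i x hx) (hdiag i).le,
        hray i _ (by rwa [hxe])⟩, ?_⟩
      simpa only [add_sub_cancel_left] using hxe

/-! ### Partial sums and permuted vectors -/

theorem partialSum_succ (b : Fin n → ℕ) (i : Fin n) :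
    partialSum b ((i : ℕ) + 1) = partialSum b i + b i := by
  unfold partialSum
  have : Finset.univ.filter (fun j : Fin n => (j : ℕ) < (i : ℕ) + 1) =
      insert i (Finset.univ.filter (fun j : Fin n => (j : ℕ) < i)) := by
    ext j
    simp [Fin.ext_iff]
    omega
  rw [this, Finset.sum_insert (by simp), add_comm]

theorem partialSum_mono (b : Fin n → ℕ) : Monotone (partialSum b) := by
  intro i j hij
  refine Finset.sum_le_sum_of_subset fun t => ?_
  simp only [Finset.mem_filter, Finset.mem_univ, true_and]
  omega

theorem partialSum_zero (b : Fin n → ℕ) : partialSum b 0 = 0 := by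
  simp [partialSum]

theorem partialSum_one (hn : 0 < n) (b : Fin n → ℕ) : partialSum b 1 = b ⟨0, hn⟩ := by
  simpa [partialSum_zero] using partialSum_succ b ⟨0, hn⟩

theorem one_le_partialSum {b : Fin n → ℕ} (hb : ∀ i, 0 < b i) (i : Fin n) :
    1 ≤ partialSum b ((i : ℕ) + 1) := by
  rw [partialSum_succ]
  have := hb i
  omega

theorem two_le_partialSum (hn : 0 < n) {b : Fin n → ℕ} (hb : ∀ i, 0 < b i) {k : ℕ} (hk : k ≤ n)
    (hk1 : 1 ≤ k) (h : 2 ≤ b ⟨0, hn⟩ ∨ 2 ≤ k) : 2 ≤ partialSum b k := by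
  rcases h with h | h
  · rw [← partialSum_one hn b] at h
    exact h.trans (partialSum_mono b hk1)
  · have h1 := hb ⟨0, hn⟩
    have h2 := hb ⟨1, by omega⟩
    have h3 := partialSum_succ b ⟨1, by omega⟩
    have h4 := partialSum_mono b h
    rw [← partialSum_one hn b] at h1
    simp only at h3
    norm_num at h3
    omega

theorem permAct_apply (π : Equiv.Perm (Fin n)) (x : Fin n → ℝ) (i : Fin n) :
    permAct π x (π i) = x i := by
  simp [permAct, Finset.sum_apply, Pi.single_apply]

theorem permAct_mul_swap_apply (π : Equiv.Perm (Fin n)) (i j : Fin n) (x : Fin n → ℝ)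
    (s : Fin n) : permAct (π * Equiv.swap i j) x (π s) = x (Equiv.swap i j s) := by
  conv_lhs => rw [← Equiv.swap_apply_self i j s]
  exact permAct_apply (π * Equiv.swap i j) x _

theorem ext_perm {u u' : Fin n → ℝ} (π : Equiv.Perm (Fin n)) (h : ∀ i, u (π i) = u' (π i)) :
    u = u' := by
  ext t
  simpa using h (π.symm t)

theorem single_perm_apply (π : Equiv.Perm (Fin n)) (i s : Fin n) :
    (Pi.single (π i) (1 : ℝ) : Fin n → ℝ) (π s) = if s = i then 1 else 0 := by
  simp [Pi.single_apply]

theorem permAct_mul_swap_sub_raise (b : Fin n → ℕ) (π : Equiv.Perm (Fin n)) {k : ℕ} {j m : Fin n}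
    (hjm : j ≤ m) (hm : (m : ℕ) + 1 = k) :
    permAct (π * Equiv.swap j m) (yVec b (k - 1)) - permAct π (yVec b k) =
      ((partialSum b k : ℝ) - 1) • Pi.single (π j) (1 : ℝ) := by
  subst hm
  have hjm' : (j : ℕ) ≤ m := hjm
  refine ext_perm π fun s => ?_
  rw [Pi.sub_apply, permAct_mul_swap_apply, permAct_apply, Pi.smul_apply, single_perm_apply]
  by_cases h1 : s = j
  · subst h1
    simp [yVec, Nat.lt_succ_of_le hjm']
  · by_cases h2 : s = m
    · subst h2
      have : (j : ℕ) < s := lt_of_le_of_ne hjm' fun h => h1 (Fin.ext h.symm)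
      simp [yVec, h1, this]
    · rw [Equiv.swap_apply_of_ne_of_ne h1 h2]
      have : (s : ℕ) ≠ m := fun h => h2 (Fin.ext h)
      have h3 : ((s : ℕ) < m + 1 - 1) ↔ (s : ℕ) < m + 1 := by omega
      simp only [yVec, h3]
      simp [h1]

theorem permAct_mul_swap_sub (b : Fin n → ℕ) (π : Equiv.Perm (Fin n)) {k : ℕ} {i j : Fin n}
    (hij : (i : ℕ) + 1 = j) (hk : k ≤ i) :
    permAct (π * Equiv.swap i j) (yVec b k) - permAct π (yVec b k) =
      (b j : ℝ) • (Pi.single (π i) (1 : ℝ) - Pi.single (π j) (1 : ℝ)) := by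
  have hne : i ≠ j := fun h => by simp [h] at hij
  have hS : (partialSum b ((j : ℕ) + 1) : ℝ) = partialSum b ((i : ℕ) + 1) + b j := by
    rw [partialSum_succ, hij]
    push_cast
    ring
  refine ext_perm π fun s => ?_
  rw [Pi.sub_apply, permAct_mul_swap_apply, permAct_apply, Pi.smul_apply, Pi.sub_apply,
    single_perm_apply, single_perm_apply]
  by_cases h1 : s = i
  · subst h1
    have h3 : ¬ (j : ℕ) < k := by omega
    have h4 : ¬ (s : ℕ) < k := by omega
    simp only [yVec, Equiv.swap_apply_left, h3, h4, if_false, hS]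
    simp [hne]
  · by_cases h2 : s = j
    · subst h2
      have h3 : ¬ (i : ℕ) < k := by omega
      have h4 : ¬ (s : ℕ) < k := by omega
      simp only [yVec, Equiv.swap_apply_right, h3, h4, if_false, hS]
      simp [h1]
    · rw [Equiv.swap_apply_of_ne_of_ne h1 h2]
      simp [h1, h2]

theorem permAct_succ_sub (b : Fin n → ℕ) (π : Equiv.Perm (Fin n)) {k : ℕ} (h : k < n) :
    permAct π (yVec b (k + 1)) - permAct π (yVec b k) =
      (-((partialSum b (k + 1) : ℝ) - 1)) • Pi.single (π ⟨k, h⟩) (1 : ℝ) := by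
  refine ext_perm π fun s => ?_
  rw [Pi.sub_apply, permAct_apply, permAct_apply, Pi.smul_apply, single_perm_apply]
  by_cases h1 : s = ⟨k, h⟩
  · subst h1
    simp [yVec]
  · have : (s : ℕ) ≠ k := fun h => h1 (Fin.ext h)
    have h3 : ((s : ℕ) < k + 1) ↔ (s : ℕ) < k := by omega
    simp [yVec, h3, h1]

theorem yVec_zero_eq_one (hn : 0 < n) {b : Fin n → ℕ} (hb1 : b ⟨0, hn⟩ = 1) :
    yVec b 0 = yVec b 1 := by
  ext i
  by_cases h : (i : ℕ) = 0
  · simp [yVec, h, partialSum_one hn, hb1]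
  · simp [yVec, h]

/-! ### Points and valid inequalities of the polytope -/

theorem permAct_yVec_mem {b : Fin n → ℕ} (hb : ∀ i, 0 < b i) (π : Equiv.Perm (Fin n)) (k : ℕ) :
    permAct π (yVec b k) ∈ parkingPolytope b := by
  let y : Fin n → ℕ := fun i => if (i : ℕ) < k then 1 else partialSum b ((i : ℕ) + 1)
  have hy1 (i) : 1 ≤ y i := by
    simp only [y]
    split_ifs
    · exact le_rfl
    · exact one_le_partialSum hb i
  have hyS (i) : y i ≤ partialSum b ((i : ℕ) + 1) := by
    simp only [y]
    split_ifs
    · exact one_le_partialSum hb i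
    · exact le_rfl
  have hmono : Monotone y := by
    intro i j hij
    have hij' : (i : ℕ) ≤ j := hij
    by_cases hi : (i : ℕ) < k
    · simpa [y, hi] using hy1 j
    · have hj : ¬ (j : ℕ) < k := by omega
      simpa [y, hi, hj] using partialSum_mono b (Nat.succ_le_succ hij')
  refine subset_convexHull ℝ _ ⟨y ∘ π.symm, ⟨fun i => hy1 _, fun i => ?_⟩, ?_⟩
  · rw [Tuple.comp_perm_comp_sort_eq_comp_sort, Tuple.sort_eq_refl_iff_monotone.2 hmono]
    exact hyS i
  · refine ext_perm π fun s => ?_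
    rw [permAct_apply]
    simp [y, yVec]

theorem convex_parkingPolytope (b : Fin n → ℕ) : Convex ℝ (parkingPolytope b) :=
  convex_convexHull ℝ _

theorem one_le_of_mem {b : Fin n → ℕ} {x : Fin n → ℝ} (hx : x ∈ parkingPolytope b) (i : Fin n) :
    1 ≤ x i := by
  have hsub : parkingPolytope b ⊆ {x | 1 ≤ (LinearMap.proj i : (Fin n → ℝ) →ₗ[ℝ] ℝ) x} := by
    refine convexHull_min ?_ (convex_halfSpace_ge (LinearMap.isLinear _) 1)
    rintro _ ⟨β, hβ, rfl⟩
    simpa using hβ.1 i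
  exact hsub hx

/-- The functional `x ↦ x_{π(m)} + x_{π(m+1)} + ⋯`, summing the coordinates at the images under `π`
of the (zero-based) indices `≥ m`. -/
def tailSum (π : Equiv.Perm (Fin n)) (m : ℕ) : (Fin n → ℝ) →ₗ[ℝ] ℝ :=
  ∑ j ∈ Finset.univ.filter (fun j : Fin n => m ≤ (j : ℕ)), LinearMap.proj (π j)

theorem tailSum_apply (π : Equiv.Perm (Fin n)) (m : ℕ) (x : Fin n → ℝ) :
    tailSum π m x = ∑ j ∈ Finset.univ.filter (fun j : Fin n => m ≤ (j : ℕ)), x (π j) := by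
  simp [tailSum]

theorem tailSum_single (π : Equiv.Perm (Fin n)) (m : ℕ) (i : Fin n) :
    tailSum π m (Pi.single (π i) 1) = if m ≤ (i : ℕ) then 1 else 0 := by
  simp only [tailSum_apply, single_perm_apply]
  simp

theorem tailSum_eq_add (π : Equiv.Perm (Fin n)) (i : Fin n) (x : Fin n → ℝ) :
    tailSum π i x = x (π i) + tailSum π ((i : ℕ) + 1) x := by
  have : Finset.univ.filter (fun j : Fin n => (i : ℕ) ≤ (j : ℕ)) =
      insert i (Finset.univ.filter (fun j : Fin n => (i : ℕ) + 1 ≤ (j : ℕ))) := by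
    ext j
    simp [Fin.ext_iff]
    omega
  rw [tailSum_apply, tailSum_apply, this, Finset.sum_insert (by simp)]

theorem tailSum_of_le (π : Equiv.Perm (Fin n)) {m : ℕ} (hm : n ≤ m) (x : Fin n → ℝ) :
    tailSum π m x = 0 := by
  rw [tailSum_apply, Finset.filter_false_of_mem, Finset.sum_empty]
  intro j _
  omega

/-- The sum of any `n - m` coordinates of a point of the polytope is at most the sum of the `n - m`
largest partial sums: for a parking function it is at most the sum of its `n - m` largest entries, by
the rearrangement inequality. -/
theorem tailSum_le {b : Fin n → ℕ} {x : Fin n → ℝ} (hx : x ∈ parkingPolytope b)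
    (π : Equiv.Perm (Fin n)) (m : ℕ) :
    tailSum π m x ≤ tailSum π m (permAct π (yVec b 0)) := by
  have hsub : parkingPolytope b ⊆
      {x | tailSum π m x ≤ tailSum π m (permAct π (yVec b 0))} := by
    refine convexHull_min ?_ (convex_halfSpace_le (LinearMap.isLinear _) _)
    rintro _ ⟨β, hβ, rfl⟩
    simp only [Set.mem_ofPred_eq, tailSum_apply, permAct_apply]
    let γ : Fin n → ℕ := β ∘ Tuple.sort β
    let τ : Equiv.Perm (Fin n) := π.trans (Tuple.sort β).symm
    have hγ (j) : β (π j) = γ (τ j) := by simp [γ, τ]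
    have hmono : Monotone γ := Tuple.monotone_sort β
    let ind : Fin n → ℕ := fun j => if m ≤ (j : ℕ) then 1 else 0
    have hind : Monotone ind := by
      intro i j hij
      have : (i : ℕ) ≤ j := hij
      simp only [ind]
      split_ifs <;> omega
    have hrearr : ∑ j, ind j * γ (τ j) ≤ ∑ j, ind j * γ j :=
      (hind.monovary hmono).sum_mul_comp_perm_le_sum_mul
    have hN : ∑ j ∈ Finset.univ.filter (fun j : Fin n => m ≤ (j : ℕ)), β (π j) ≤
        ∑ j ∈ Finset.univ.filter (fun j : Fin n => m ≤ (j : ℕ)), partialSum b ((j : ℕ) + 1) := by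
      refine le_trans ?_ (Finset.sum_le_sum fun j _ => hβ.2 j)
      simpa only [hγ, ind, Finset.sum_filter, ite_mul, one_mul, zero_mul] using hrearr
    simp only [yVec, Nat.not_lt_zero, if_false]
    exact_mod_cast hN
  exact hsub hx

theorem tailSum_permAct_yVec (b : Fin n → ℕ) (π : Equiv.Perm (Fin n)) {k m : ℕ} (h : k ≤ m) :
    tailSum π m (permAct π (yVec b k)) = tailSum π m (permAct π (yVec b 0)) := by
  simp only [tailSum_apply, permAct_apply]
  refine Finset.sum_congr rfl fun j hj => ?_
  have : ¬ (j : ℕ) < k := by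
    have := (Finset.mem_filter.1 hj).2
    omega
  simp [yVec, this]

/-! ### The tangent cone at a vertex -/

/-- Functionals attaining their minimum over the polytope at `π(y_k)`: the coordinates in which that
point has its `k` leading ones, and the negated tail sums starting at the other positions. -/
def tightFunctional (π : Equiv.Perm (Fin n)) (k : ℕ) (i : Fin n) : (Fin n → ℝ) →ₗ[ℝ] ℝ :=
  if (i : ℕ) < k then LinearMap.proj (π i) else -tailSum π i

theorem tightFunctional_nonneg {b : Fin n → ℕ} (π : Equiv.Perm (Fin n)) (k : ℕ) (i : Fin n)
    {x : Fin n → ℝ} (hx : x ∈ parkingPolytope b) :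
    0 ≤ tightFunctional π k i (x - permAct π (yVec b k)) := by
  unfold tightFunctional
  split_ifs with h
  · have := one_le_of_mem hx (π i)
    rw [LinearMap.proj_apply, Pi.sub_apply, permAct_apply]
    simpa [yVec, h] using this
  · have := tailSum_le hx π i
    rw [LinearMap.neg_apply, map_sub, tailSum_permAct_yVec b π (not_lt.1 h)]
    linarith

theorem eq_zero_of_tightFunctional (π : Equiv.Perm (Fin n)) (k : ℕ) (u : Fin n → ℝ)
    (hu : ∀ i, tightFunctional π k i u = 0) : u = 0 := by
  refine ext_perm π fun i => ?_
  have hi := hu i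
  unfold tightFunctional at hi
  split_ifs at hi with h
  · simpa using hi
  · rw [LinearMap.neg_apply, neg_eq_zero, tailSum_eq_add] at hi
    have htail : tailSum π ((i : ℕ) + 1) u = 0 := by
      by_cases hin : (i : ℕ) + 1 < n
      · have := hu ⟨(i : ℕ) + 1, hin⟩
        have h' : ¬ (i : ℕ) + 1 < k := by omega
        simpa [tightFunctional, h'] using this
      · exact tailSum_of_le π (not_lt.1 hin) u
    simpa [htail] using hi

theorem permAct_yVec_mem_extremePoints {b : Fin n → ℕ} (hb : ∀ i, 0 < b i)
    (π : Equiv.Perm (Fin n)) (k : ℕ) :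
    permAct π (yVec b k) ∈ (parkingPolytope b).extremePoints ℝ :=
  mem_extremePoints_of_functionals (tightFunctional π k) (permAct_yVec_mem hb π k)
    (fun i _ hx => tightFunctional_nonneg π k i hx) (eq_zero_of_tightFunctional π k)

/-- The predecessor of an index, with the junk value `0` at `0`. -/
def predIdx (i : Fin n) : Fin n := ⟨(i : ℕ) - 1, by omega⟩

/-- The edge directions at `π(y_k)` when `b_1 ≥ 2` or `k ≥ 2`: raise one of the `k` leading ones to
`S_k`, lower the entry `S_{k+1}` to `1`, or exchange two consecutive partial sums. -/
def edgeDir (b : Fin n → ℕ) (π : Equiv.Perm (Fin n)) (k : ℕ) (i : Fin n) : Fin n → ℝ :=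
  if (i : ℕ) < k then ((partialSum b k : ℝ) - 1) • Pi.single (π i) (1 : ℝ)
  else if (i : ℕ) = k then (-((partialSum b (k + 1) : ℝ) - 1)) • Pi.single (π i) (1 : ℝ)
  else (b i : ℝ) • (Pi.single (π (predIdx i)) (1 : ℝ) - Pi.single (π i) (1 : ℝ))

theorem tightFunctional_edgeDir_of_ne (b : Fin n → ℕ) (π : Equiv.Perm (Fin n)) (k : ℕ)
    {i j : Fin n} (hij : i ≠ j) : tightFunctional π k i (edgeDir b π k j) = 0 := by
  have hij' : (i : ℕ) ≠ j := fun h => hij (Fin.ext h)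
  unfold tightFunctional edgeDir
  split_ifs with h1 h2 h3 h2 h3
  · simp [hij]
  · simp [hij]
  · have : i ≠ predIdx j := fun h => by simp [h, predIdx] at h1; omega
    simp [hij, this]
  · have : ¬ (i : ℕ) ≤ j := by omega
    simp [tailSum_single, this]
  · have : ¬ (i : ℕ) ≤ j := by omega
    simp [tailSum_single, this]
  · have : (i : ℕ) ≤ predIdx j ↔ (i : ℕ) ≤ j := by simp [predIdx]; omega
    simp [tailSum_single, this]

theorem tightFunctional_edgeDir_pos (hn : 0 < n) {b : Fin n → ℕ} (hb : ∀ i, 0 < b i)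
    (π : Equiv.Perm (Fin n)) {k : ℕ} (hk : k ≤ n) (h : 2 ≤ b ⟨0, hn⟩ ∨ 2 ≤ k) (i : Fin n) :
    0 < tightFunctional π k i (edgeDir b π k i) := by
  unfold tightFunctional edgeDir
  split_ifs with h1 h2
  · have := two_le_partialSum hn hb hk (by omega) h
    simp
    omega
  · have := two_le_partialSum hn hb (k := k + 1) (by omega) (by omega)
      (h.imp_right fun h => by omega)
    simp [tailSum_single]
    omega
  · have : ¬ (i : ℕ) ≤ predIdx i := by simp [predIdx]; omega
    simp [tailSum_single, this, hb i]

/-- The points of the orbit of the `y_l` listed as neighbours of `π(y_k)` are its translates by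
`edgeDir`. -/
theorem exists_sub_eq_edgeDir_iff (b : Fin n → ℕ) (π : Equiv.Perm (Fin n)) {k : ℕ} (hk : k ≤ n)
    (w : Fin n → ℝ) :
    (∃ i, w - permAct π (yVec b k) = edgeDir b π k i) ↔
      (∃ j m : Fin n, j ≤ m ∧ (m : ℕ) + 1 = k ∧
          w = permAct (π * Equiv.swap j m) (yVec b (k - 1))) ∨
        (∃ i j : Fin n, (i : ℕ) + 1 = j ∧ k + 2 ≤ (j : ℕ) + 1 ∧
          w = permAct (π * Equiv.swap i j) (yVec b k)) ∨
        (k + 1 ≤ n ∧ w = permAct π (yVec b (k + 1))) := by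
  constructor
  · rintro ⟨i, hi⟩
    unfold edgeDir at hi
    split_ifs at hi with h1 h2
    · refine Or.inl ⟨i, ⟨k - 1, by omega⟩, Fin.mk_le_mk.2 (by omega), by simp; omega, ?_⟩
      rw [← permAct_mul_swap_sub_raise b π (m := ⟨k - 1, by omega⟩) (Fin.mk_le_mk.2 (by omega))
        (by simp; omega)] at hi
      exact sub_left_injective hi
    · refine Or.inr (Or.inr ⟨by omega, ?_⟩)
      have hik : i = ⟨k, by omega⟩ := Fin.ext h2
      rw [hik, ← permAct_succ_sub b π] at hi
      exact sub_left_injective hi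
    · have hp : (predIdx i : ℕ) + 1 = i := by simp [predIdx]; omega
      refine Or.inr (Or.inl ⟨predIdx i, i, hp, by omega, ?_⟩)
      rw [← permAct_mul_swap_sub b π hp (by omega : k ≤ (predIdx i : ℕ))] at hi
      exact sub_left_injective hi
  · rintro (⟨j, m, hjm, hm, rfl⟩ | ⟨i, j, hij, hj, rfl⟩ | ⟨hk1, rfl⟩)
    · refine ⟨j, ?_⟩
      have hjm' : (j : ℕ) ≤ m := hjm
      rw [permAct_mul_swap_sub_raise b π hjm hm, edgeDir, if_pos (by omega)]
    · refine ⟨j, ?_⟩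
      have hp : predIdx j = i := Fin.ext (by simp [predIdx]; omega)
      rw [permAct_mul_swap_sub b π hij (by omega), edgeDir, if_neg (by omega),
        if_neg (by omega), hp]
    · refine ⟨⟨k, hk1⟩, ?_⟩
      rw [permAct_succ_sub b π hk1, edgeDir, if_neg (by simp), if_pos rfl]

theorem sharesEdge_iff (hn : 0 < n) {b : Fin n → ℕ} (hb : ∀ i, 0 < b i)
    (π : Equiv.Perm (Fin n)) {k : ℕ} (hk : k ≤ n) (h : 2 ≤ b ⟨0, hn⟩ ∨ 2 ≤ k) (w : Fin n → ℝ) :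
    SharesEdge (parkingPolytope b) (permAct π (yVec b k)) w ↔
      (∃ j m : Fin n, j ≤ m ∧ (m : ℕ) + 1 = k ∧
          w = permAct (π * Equiv.swap j m) (yVec b (k - 1))) ∨
        (∃ i j : Fin n, (i : ℕ) + 1 = j ∧ k + 2 ≤ (j : ℕ) + 1 ∧
          w = permAct (π * Equiv.swap i j) (yVec b k)) ∨
        (k + 1 ≤ n ∧ w = permAct π (yVec b (k + 1))) := by
  rw [← exists_sub_eq_edgeDir_iff b π hk w]
  refine sharesEdge_iff_of_dual (tightFunctional π k) (edgeDir b π k) (convex_parkingPolytope b)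
    (permAct_yVec_mem hb π k) (fun i => ?_) (fun i _ hx => tightFunctional_nonneg π k i hx)
    (eq_zero_of_tightFunctional π k) (fun i j => tightFunctional_edgeDir_of_ne b π k)
    (tightFunctional_edgeDir_pos hn hb π hk h) w
  rcases (exists_sub_eq_edgeDir_iff b π hk _).1 ⟨i, add_sub_cancel_left _ _⟩ with
    ⟨j, m, -, -, h⟩ | ⟨i, j, -, -, h⟩ | ⟨-, h⟩
  all_goals
    rw [h]
    exact permAct_yVec_mem_extremePoints hb _ _

/-! ### The case `b_1 = 1`, `k ≤ 1` -/

/-- When `b_1 = 1`, the inequality bounding the `n - 1` last coordinates follows from the one bounding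
all of them together with `x_1 ≥ 1`; it is replaced by the bound on all coordinates, which is also
tight at `π(y_1) = π(y_0)`. -/
def tightFunctional' (π : Equiv.Perm (Fin n)) (i : Fin n) : (Fin n → ℝ) →ₗ[ℝ] ℝ :=
  if (i : ℕ) = 0 then LinearMap.proj (π i) else -tailSum π (if (i : ℕ) = 1 then 0 else i)

/-- The edge directions at `π(y_1)` when `b_1 = 1` and `n ≥ 2`: exchange two consecutive entries, or
lower the entry `S_2` to `1`. The index `0` stands for the exchange of the first two entries. -/
def edgeDir' (b : Fin n → ℕ) (h : 1 < n) (π : Equiv.Perm (Fin n)) (i : Fin n) : Fin n → ℝ :=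
  if (i : ℕ) = 0 then
    (b ⟨1, h⟩ : ℝ) • (Pi.single (π i) (1 : ℝ) - Pi.single (π ⟨1, h⟩) (1 : ℝ))
  else if (i : ℕ) = 1 then (-(b ⟨1, h⟩ : ℝ)) • Pi.single (π i) (1 : ℝ)
  else (b i : ℝ) • (Pi.single (π (predIdx i)) (1 : ℝ) - Pi.single (π i) (1 : ℝ))

theorem tightFunctional'_nonneg (hn : 0 < n) {b : Fin n → ℕ} (hb1 : b ⟨0, hn⟩ = 1)
    (π : Equiv.Perm (Fin n)) (i : Fin n) {x : Fin n → ℝ} (hx : x ∈ parkingPolytope b) :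
    0 ≤ tightFunctional' π i (x - permAct π (yVec b 1)) := by
  unfold tightFunctional'
  split_ifs with h h1
  all_goals try rw [← yVec_zero_eq_one hn hb1, LinearMap.neg_apply, map_sub]
  · have := one_le_of_mem hx (π i)
    rw [LinearMap.proj_apply, Pi.sub_apply, permAct_apply]
    simpa [yVec, h] using this
  · linarith [tailSum_le hx π 0]
  · linarith [tailSum_le hx π i]

theorem eq_zero_of_tightFunctional' (hn : 1 < n) (π : Equiv.Perm (Fin n)) (u : Fin n → ℝ)
    (hu : ∀ i, tightFunctional' π i u = 0) : u = 0 := by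
  refine eq_zero_of_tightFunctional π 1 u fun i => ?_
  have h0 : u (π ⟨0, by omega⟩) = 0 := by simpa [tightFunctional'] using hu ⟨0, by omega⟩
  have h1 : tailSum π 0 u = 0 := by simpa [tightFunctional'] using hu ⟨1, hn⟩
  have h2 := tailSum_eq_add π ⟨0, by omega⟩ u
  have hi := hu i
  unfold tightFunctional' at hi
  unfold tightFunctional
  split_ifs at hi with h h'
  · simpa [h] using hi
  · simp only [h0, h1, zero_add] at h2
    simp [h', ← h2]
  · rw [if_neg (by omega)]
    exact hi

theorem tightFunctional'_edgeDir'_of_ne (b : Fin n → ℕ) (hn : 1 < n) (π : Equiv.Perm (Fin n))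
    {i j : Fin n} (hij : i ≠ j) : tightFunctional' π i (edgeDir' b hn π j) = 0 := by
  have hij' : (i : ℕ) ≠ j := fun h => hij (Fin.ext h)
  unfold tightFunctional' edgeDir'
  split_ifs with h1 h2 h3 h4 h5 h6 h7 h8
  · omega
  · simp [hij]
  · have : i ≠ predIdx j := fun h => by simp [h, predIdx] at h1; omega
    simp [hij, this]
  · simp [tailSum_single]
  · omega
  · simp [tailSum_single]
  · have : ¬ (i : ℕ) ≤ 1 := by omega
    simp [tailSum_single, this, h1, h7]
  · have : ¬ (i : ℕ) ≤ j := by omega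
    simp [tailSum_single, this]
  · have : (i : ℕ) ≤ predIdx j ↔ (i : ℕ) ≤ j := by simp [predIdx]; omega
    simp [tailSum_single, this]

theorem tightFunctional'_edgeDir'_pos {b : Fin n → ℕ} (hb : ∀ i, 0 < b i) (hn : 1 < n)
    (π : Equiv.Perm (Fin n)) (i : Fin n) : 0 < tightFunctional' π i (edgeDir' b hn π i) := by
  unfold tightFunctional' edgeDir'
  split_ifs with h1 h2
  · have : i ≠ ⟨1, hn⟩ := fun h => by simp [h] at h1
    simp [this, hb]
  · simp [tailSum_single, hb]
  · have : ¬ (i : ℕ) ≤ predIdx i := by simp [predIdx]; omega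
    simp [tailSum_single, this, hb i]

theorem permAct_mul_swap_sub_of_eq_one (hn : 0 < n) {b : Fin n → ℕ} (hb1 : b ⟨0, hn⟩ = 1)
    (π : Equiv.Perm (Fin n)) {i j : Fin n} (hij : (i : ℕ) + 1 = j) :
    permAct (π * Equiv.swap i j) (yVec b 1) - permAct π (yVec b 1) =
      (b j : ℝ) • (Pi.single (π i) (1 : ℝ) - Pi.single (π j) (1 : ℝ)) := by
  rw [← yVec_zero_eq_one hn hb1]
  exact permAct_mul_swap_sub b π hij (Nat.zero_le _)

theorem permAct_two_sub (hn : 0 < n) {b : Fin n → ℕ} (hb1 : b ⟨0, hn⟩ = 1)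
    (π : Equiv.Perm (Fin n)) (h : 1 < n) :
    permAct π (yVec b 2) - permAct π (yVec b 1) =
      (-(b ⟨1, h⟩ : ℝ)) • Pi.single (π ⟨1, h⟩) (1 : ℝ) := by
  have hS : partialSum b (1 + 1) = 1 + b ⟨1, h⟩ := by
    have := partialSum_one hn b
    have := partialSum_succ b ⟨1, h⟩
    simp only at this
    omega
  rw [permAct_succ_sub b π h, hS]
  push_cast
  rw [add_sub_cancel_left]

theorem exists_sub_eq_edgeDir'_iff (hn : 0 < n) {b : Fin n → ℕ} (hb1 : b ⟨0, hn⟩ = 1) (h : 1 < n)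
    (π : Equiv.Perm (Fin n)) (w : Fin n → ℝ) :
    (∃ i, w - permAct π (yVec b 1) = edgeDir' b h π i) ↔
      (∃ i j : Fin n, (i : ℕ) + 1 = j ∧ w = permAct (π * Equiv.swap i j) (yVec b 1)) ∨
        w = permAct π (yVec b 2) := by
  constructor
  · rintro ⟨i, hi⟩
    unfold edgeDir' at hi
    split_ifs at hi with h1 h2
    · have hp : (i : ℕ) + 1 = (⟨1, h⟩ : Fin n) := by simp [h1]
      rw [← permAct_mul_swap_sub_of_eq_one hn hb1 π hp] at hi
      exact Or.inl ⟨i, ⟨1, h⟩, hp, sub_left_injective hi⟩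
    · obtain rfl : i = ⟨1, h⟩ := Fin.ext h2
      rw [← permAct_two_sub hn hb1 π] at hi
      exact Or.inr (sub_left_injective hi)
    · have hp : (predIdx i : ℕ) + 1 = i := by simp [predIdx]; omega
      rw [← permAct_mul_swap_sub_of_eq_one hn hb1 π hp] at hi
      exact Or.inl ⟨predIdx i, i, hp, sub_left_injective hi⟩
  · rintro (⟨i, j, hij, rfl⟩ | rfl)
    · rw [permAct_mul_swap_sub_of_eq_one hn hb1 π hij]
      by_cases h1 : (i : ℕ) = 0
      · obtain rfl : j = ⟨1, h⟩ := Fin.ext (by simp; omega)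
        exact ⟨i, by rw [edgeDir', if_pos h1]⟩
      · have hp : predIdx j = i := Fin.ext (by simp [predIdx]; omega)
        exact ⟨j, by rw [edgeDir', if_neg (by omega), if_neg (by omega), hp]⟩
    · rw [permAct_two_sub hn hb1 π h]
      exact ⟨⟨1, h⟩, by rw [edgeDir', if_neg (by simp), if_pos rfl]⟩

theorem sharesEdge_iff_of_eq_one (hn : 0 < n) {b : Fin n → ℕ} (hb : ∀ i, 0 < b i)
    (hb1 : b ⟨0, hn⟩ = 1) (h : 1 < n) (π : Equiv.Perm (Fin n)) (w : Fin n → ℝ) :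
    SharesEdge (parkingPolytope b) (permAct π (yVec b 1)) w ↔
      (∃ i j : Fin n, (i : ℕ) + 1 = j ∧ w = permAct (π * Equiv.swap i j) (yVec b 1)) ∨
        w = permAct π (yVec b 2) := by
  rw [← exists_sub_eq_edgeDir'_iff hn hb1 h π w]
  refine sharesEdge_iff_of_dual (tightFunctional' π) (edgeDir' b h π) (convex_parkingPolytope b)
    (permAct_yVec_mem hb π 1) (fun i => ?_) (fun i _ hx => tightFunctional'_nonneg hn hb1 π i hx)
    (eq_zero_of_tightFunctional' h π) (fun i j => tightFunctional'_edgeDir'_of_ne b h π)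
    (tightFunctional'_edgeDir'_pos hb h π) w
  rcases (exists_sub_eq_edgeDir'_iff hn hb1 h π _).1 ⟨i, add_sub_cancel_left _ _⟩ with
    ⟨i, j, -, h⟩ | h
  all_goals
    rw [h]
    exact permAct_yVec_mem_extremePoints hb _ _

end ParkingPolytope

/-- Indices in `Fin n` are zero-based: the entry, basis vector or position numbered `j` in the usual
`1, …, n` numbering is the one with value `j - 1`. -/
theorem mainTheorem2 (n : ℕ) (hn : 0 < n) (b : Fin n → ℕ) (hb : ∀ i, 0 < b i)
    (hnd : ¬ (n = 1 ∧ b ⟨0, hn⟩ = 1))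
    (v w : Fin n → ℝ)
    (hv : IsVertex (parkingPolytope b) v) (hw : IsVertex (parkingPolytope b) w)
    (π : Equiv.Perm (Fin n)) (k : ℕ) (hk : k ≤ n) (hvk : v = permAct π (yVec b k)) :
    ((2 ≤ b ⟨0, hn⟩ ∨ (b ⟨0, hn⟩ = 1 ∧ 2 ≤ k)) →
      (SharesEdge (parkingPolytope b) v w ↔
        ((∃ j m : Fin n, j ≤ m ∧ (m : ℕ) + 1 = k ∧
            w = permAct (π * Equiv.swap j m) (yVec b (k - 1))) ∨
          (∃ i j : Fin n, (i : ℕ) + 1 = j ∧ k + 2 ≤ (j : ℕ) + 1 ∧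
            w = permAct (π * Equiv.swap i j) (yVec b k)) ∨
          (k + 1 ≤ n ∧ w = permAct π (yVec b (k + 1))))) ∧
      (∀ j m : Fin n, j ≤ m → (m : ℕ) + 1 = k →
        w = permAct (π * Equiv.swap j m) (yVec b (k - 1)) →
          w - v = ((partialSum b k : ℝ) - 1) • Pi.single (π j) (1 : ℝ)) ∧
      (∀ i j : Fin n, (i : ℕ) + 1 = j → k + 2 ≤ (j : ℕ) + 1 →
        w = permAct (π * Equiv.swap i j) (yVec b k) →
          w - v = (b j : ℝ) • (Pi.single (π i) (1 : ℝ) - Pi.single (π j) (1 : ℝ))) ∧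
      (∀ h : k < n, w = permAct π (yVec b (k + 1)) →
          w - v = (-((partialSum b (k + 1) : ℝ) - 1)) • Pi.single (π ⟨k, h⟩) (1 : ℝ))) ∧
    ((b ⟨0, hn⟩ = 1 ∧ (k = 0 ∨ k = 1)) →
      (SharesEdge (parkingPolytope b) v w ↔
        ((∃ i j : Fin n, (i : ℕ) + 1 = j ∧
            w = permAct (π * Equiv.swap i j) (yVec b 1)) ∨
          w = permAct π (yVec b 2))) ∧
      (∀ i j : Fin n, (i : ℕ) + 1 = j →
        w = permAct (π * Equiv.swap i j) (yVec b 1) →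
          w - v = (b j : ℝ) • (Pi.single (π i) (1 : ℝ) - Pi.single (π j) (1 : ℝ))) ∧
      (∀ h : 1 < n, w = permAct π (yVec b 2) →
          w - v = (-(b ⟨1, h⟩ : ℝ)) • Pi.single (π ⟨1, h⟩) (1 : ℝ))) := by
  subst hvk
  refine ⟨fun h => ⟨?_, ?_, ?_, ?_⟩, ?_⟩
  · exact sharesEdge_iff hn hb π hk (h.imp_right And.right) w
  · rintro j m hjm hm rfl
    exact permAct_mul_swap_sub_raise b π hjm hm
  · rintro i j hij hj rfl
    exact permAct_mul_swap_sub b π hij (by omega)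
  · rintro h rfl
    exact permAct_succ_sub b π h
  · rintro ⟨hb1, hk01⟩
    have hn1 : 1 < n := by
      by_contra! hle
      exact hnd ⟨by omega, hb1⟩
    have hy : yVec b k = yVec b 1 := by
      rcases hk01 with rfl | rfl
      · exact yVec_zero_eq_one hn hb1
      · rfl
    rw [hy]
    refine ⟨sharesEdge_iff_of_eq_one hn hb hb1 hn1 π w, ?_, ?_⟩
    · rintro i j hij rfl
      exact permAct_mul_swap_sub_of_eq_one hn hb1 π hij
    · rintro h rfl
      exact permAct_two_sub hn hb1 π h
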